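/- A \emph{tournament} is a digraph without loops in which every two distinct vertices are joined by exactly one of the two possible directed edges; it is \emph{transitive} if its edge relation is transitive. For integers $a,b,c\ge 1$, let $T[a,b,c]$ be the tournament whose vertex set is partitioned into parts $A,B,C$ with $|A|=a$, $|B|=b$, $|C|=c$, each of which induces a transitive tournament, and in which all edges between different parts are directed from $A$ to $B$, from $B$ to $C$ and from $C$ to $A$. A \emph{tournamenton} is a measurable function $W:[0,1]^2\to[0,1]$ with $W(x,y)+W(y,x)=1$ for all $(x,y)\in[0,1]^2$; it is \emph{regular} if $\int_0^1 W(x,y)\,\mathrm{d}y=\frac12$ for almost every $x\in[0,1]$. The homomorphism density of a finite digraph $H$ in $W$ is \[t(H,W)=\int_{[0,1]^{V(H)}}\prod_{vw\in E(H)}W(x_v,x_w)\,\mathrm{d}x_{V(H)},\] and $t(H,1/2)$ denotes the homomorphism density of $H$ in the constant tournamenton $W\equiv 1/2$. Let $T$ be a finite tournament. Then $t(T,1/2)=2^{-\binom{|V(T)|}{2}}$, and the inequality \[t(T,W)\ge t(T,1/2)=2^{-\binom{|V(T)|}{2}}\] holds for every regular tournamenton $W$ if and only if $T$ is a transitive tournament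 or $T$ is isomorphic to $T[a,b,c]$ for some integers $a,b,c\ge 1$. -/

import Mathlib

open MeasureTheory
open scoped unitInterval

/-- A digraph is a tournament if it has no loops and every pair of distinct vertices is joined by
exactly one of the two possible edges. -/
def Digraph.IsTournament {V : Type*} (T : Digraph V) : Prop :=
  (∀ v, ¬ T.Adj v v) ∧ ∀ u v, u ≠ v → Xor (T.Adj u v) (T.Adj v u)

/-- A transitive tournament is a tournament whose edge relation is transitive. -/
def Digraph.IsTransitiveTournament {V : Type*} (T : Digraph V) : Prop :=
  T.IsTournament ∧ ∀ u v w, T.Adj u v → T.Adj v w → T.Adj u w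

/-- Isomorphism of digraphs. -/
def Digraph.IsIsomorphic {V V' : Type*} (G : Digraph V) (H : Digraph V') : Prop :=
  Nonempty (G.Adj ≃r H.Adj)

/-- The vertices of the blow-up of a triangle: three parts, of sizes `a`, `b`, `c`.
A vertex is a pair consisting of its part and its index inside that part. -/
abbrev BlowupVertex (a b c : ℕ) : Type := (i : Fin 3) × Fin (![a, b, c] i)

/-- The digraph `C[a,b,c]`, the blow-up of the cyclically oriented triangle: the edges go from the
`a`-part to the `b`-part, from the `b`-part to the `c`-part, and from the `c`-part to the `a`-part
(addition in `Fin 3` is modulo `3`). -/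
def cyclicBlowup (a b c : ℕ) : Digraph (BlowupVertex a b c) where
  Adj u v := v.1 = u.1 + 1

/-- The tournament `T[a,b,c]`: the digraph `C[a,b,c]` together with a transitive tournament on the
vertices of each of its three parts. -/
def cyclicBlowupTournament (a b c : ℕ) : Digraph (BlowupVertex a b c) where
  Adj u v := (cyclicBlowup a b c).Adj u v ∨ (u.1 = v.1 ∧ (u.2 : ℕ) < (v.2 : ℕ))

/-- A tournamenton: a measurable function `W : [0,1]² → [0,1]` with `W(x,y) + W(y,x) = 1`
for all `x`, `y`. -/
structure Tournamenton where
  toFun : I → I → ℝ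
  measurable' : Measurable (Function.uncurry toFun)
  mem_Icc' : ∀ x y, toFun x y ∈ Set.Icc (0 : ℝ) 1
  add_swap' : ∀ x y, toFun x y + toFun y x = 1

namespace Tournamenton

/-- The constant tournamenton with value `1/2`. -/
noncomputable def half : Tournamenton where
  toFun _ _ := 1 / 2
  measurable' := measurable_const
  mem_Icc' _ _ := by constructor <;> norm_num
  add_swap' _ _ := by norm_num

/-- A tournamenton `W` is regular if `∫ W(x,y) dy = 1/2` for almost every `x`. -/
def IsRegular (W : Tournamenton) : Prop :=
  ∀ᵐ x : I, ∫ y : I, W.toFun x y = 1 / 2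

end Tournamenton

open Classical in
/-- The edge set of a digraph on a finite vertex set, as a set of ordered pairs. -/
noncomputable def Digraph.edgeFinset {V : Type*} [Fintype V] (H : Digraph V) : Finset (V × V) :=
  {e : V × V | H.Adj e.1 e.2}

/-- The homomorphism density `t(H,W) = ∫ ∏_{vw ∈ E(H)} W(x_v,x_w) dx` over `x ∈ [0,1]^{V(H)}`. -/
noncomputable def homDensity {V : Type*} [Fintype V] (H : Digraph V) (W : Tournamenton) : ℝ :=
  ∫ x : V → I, ∏ e ∈ H.edgeFinset, W.toFun (x e.1) (x e.2)

/-!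
# Tournaments whose density in regular tournamentons is minimized by the constant `1 / 2`

**Lower bounds.** For a transitive tournament with vertex weights `f`, removing the source and
absorbing its edges in the weights gives, with Jensen's inequality, the bound
`(∫ f) ^ n ≤ 2 ^ (n choose 2) * density` (`pow_le_transitive_density`); no regularity is needed.
Once the positions of two parts of `T[a,b,c]` are fixed, the third part is such a weighted
transitive tournament, so the edges inside the parts can be dropped at the price `1 / 2` each
(`pow_le_cyclicBlowupTournament_density`).

There remains the blow-up `C[a,b,c]` of the cyclic triangle (`pow_le_cyclicBlowup_density`). Let
the third part be mapped to `z`, let `F z` and `G z` be the sizes of the common out-neighborhood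
and the common in-neighborhood of `z`, and `D z` the edge mass from the first to the second. The
weighted Sidorenko inequality for `K_{a,b}` bounds the density `P z` of the remaining edges by
`D ^ (a * b) ≤ P * F ^ (a * b - a) * G ^ (a * b - b)` (`pow_le_bipartite_density`). By
regularity `∫ F = ∫ G = 2 ^ (-c)`. Moreover `κ x y = ∫ w y t * w t x dt` is equal to one half
minus the common in-degree of `x` and `y`, hence symmetric, so that
`∫ D = ∫∫ w x y * κ x y ^ c = (1 / 2) * ∫∫ κ ^ c = (1 / 2) * ∫ F * G`, and the last integral is at
least `4 ^ (-c)`. Hölder's inequality for the four functions `P`, `F`, `G`, `F * G` combines these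
facts.

**Necessity.** Two regular tournamentons in which the other tournaments have density zero come from
compact groups with a set `P` of positive elements such that `P`, `-P` partition the group up to a
null set (`exists_isRegular_of_positive`); their regularity is the invariance of Haar measure. On
the circle, with `P` an open half circle, only locally transitive tournaments have positive density.
On sequences of ternary digits, with `P` the sequences with first nonzero digit `1`, a tournament of
positive density with at least two vertices is a cyclic sum of parts, at least two of which are
nonempty. A tournament with both properties has acyclic parts; it is transitive if one of the three
parts is empty, and of the form `T[a,b,c]` otherwise (`transitive_or_cyclicBlowup`).
-/

open scoped ENNReal

/-! ### Weighted densities of transitive and bipartite graphs -/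

/-- Hölder's inequality with natural exponents. -/
theorem pow_lintegral_le_of_pow_le {Y ι : Type*} [MeasurableSpace Y] {μ : Measure Y}
    [Fintype ι] {N : ℕ} (hN : N ≠ 0) {D : Y → ℝ≥0∞} {f : ι → Y → ℝ≥0∞}
    (hf : ∀ i, Measurable (f i)) {k : ι → ℕ} (hk : ∑ i, k i = N)
    (h : ∀ y, D y ^ N ≤ ∏ i, f i y ^ k i) :
    (∫⁻ y, D y ∂μ) ^ N ≤ ∏ i, (∫⁻ y, f i y ∂μ) ^ k i := by
  have hN' : (N : ℝ) ≠ 0 := by exact_mod_cast hN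
  have root : ∀ (t : ℝ≥0∞) (m : ℕ), (t ^ m) ^ ((N : ℝ)⁻¹) = t ^ ((m : ℝ) / N) := fun t m => by
    rw [← ENNReal.rpow_natCast, ← ENNReal.rpow_mul, div_eq_mul_inv]
  have hD : ∀ y, D y ≤ ∏ i, f i y ^ ((k i : ℝ) / N) := fun y => by
    have h1 := ENNReal.rpow_le_rpow (h y) (inv_nonneg.2 (Nat.cast_nonneg N))
    rw [root, div_self hN', ENNReal.rpow_one,
      ← ENNReal.prod_rpow_of_nonneg (inv_nonneg.2 (Nat.cast_nonneg N))] at h1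
    simpa only [root] using h1
  have key := (lintegral_mono hD).trans (ENNReal.lintegral_prod_norm_pow_le (μ := μ) Finset.univ
    (f := f) (fun i _ => (hf i).aemeasurable) (p := fun i => (k i : ℝ) / N)
    (by rw [← Finset.sum_div, ← Nat.cast_sum, hk, div_self hN']) (fun i _ => by positivity))
  refine (pow_le_pow_left₀ zero_le key N).trans_eq ?_
  rw [← Finset.prod_pow]
  refine Finset.prod_congr rfl fun i _ => ?_
  rw [← ENNReal.rpow_natCast, ← ENNReal.rpow_mul, div_mul_cancel₀ _ hN', ENNReal.rpow_natCast]

/-- Jensen's inequality for `t ↦ t ^ (n + 1)` and the measure with density `p`. -/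
theorem pow_lintegral_mul_le {Y : Type*} [MeasurableSpace Y] {μ : Measure Y} (n : ℕ)
    {p h : Y → ℝ≥0∞} (hp : Measurable p) (hh : Measurable h) :
    (∫⁻ y, p y * h y ∂μ) ^ (n + 1) ≤ (∫⁻ y, p y ∂μ) ^ n * ∫⁻ y, p y * h y ^ (n + 1) ∂μ := by
  have := pow_lintegral_le_of_pow_le (μ := μ) (N := n + 1) (by simp) (D := fun y => p y * h y)
    (f := ![p, fun y => p y * h y ^ (n + 1)]) (k := ![n, 1])
    (by intro i; fin_cases i <;> simp <;> fun_prop) (by simp)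
    (fun y => by simp only [Fin.prod_univ_two, Matrix.cons_val_zero, Matrix.cons_val_one, mul_pow,
      pow_succ]; exact le_of_eq (by ring))
  simpa using this

/-- The contribution to a homomorphism density of the edges inside a transitive tournament whose
vertices are mapped to `x 0, …, x (n - 1)`. -/
noncomputable def transProd {X : Type*} (w : X → X → ℝ≥0∞) {n : ℕ} (x : Fin n → X) : ℝ≥0∞ :=
  ∏ i, ∏ j, if i < j then w (x i) (x j) else 1

theorem measurable_transProd {X : Type*} [MeasurableSpace X] {w : X → X → ℝ≥0∞}
    (hw : Measurable (Function.uncurry w)) (n : ℕ) :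
    Measurable (transProd w : (Fin n → X) → ℝ≥0∞) := by
  unfold transProd
  refine Finset.measurable_prod _ fun i _ => Finset.measurable_prod _ fun j _ => ?_
  split_ifs <;> fun_prop

theorem transProd_cons {X : Type*} (w : X → X → ℝ≥0∞) {n : ℕ} (x₀ : X) (x : Fin n → X) :
    transProd w (Fin.cons x₀ x : Fin (n + 1) → X) = (∏ j, w x₀ (x j)) * transProd w x := by
  simp [transProd, Fin.prod_univ_succ]

section Kernel

variable {X : Type*} [MeasureSpace X] [IsProbabilityMeasure (volume : Measure X)]

theorem lintegral_fin_succ {n : ℕ} {F : (Fin (n + 1) → X) → ℝ≥0∞} (hF : Measurable F) :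
    ∫⁻ x, F x = ∫⁻ x₀ : X, ∫⁻ y : Fin n → X, F (Fin.cons x₀ y) := by
  have h := volume_preserving_piFinSuccAbove (fun _ : Fin (n + 1) => X) 0
  rw [← h.symm.lintegral_comp hF, Measure.volume_eq_prod, lintegral_prod]
  · simp [MeasurableEquiv.piFinSuccAbove, Fin.insertNthEquiv, Fin.insertNth_zero']
  · exact (hF.comp (MeasurableEquiv.measurable _)).aemeasurable

theorem lintegral_fin_prod_eq_pow (n : ℕ) {h : X → ℝ≥0∞} (hh : Measurable h) :
    ∫⁻ z : Fin n → X, ∏ k, h (z k) = (∫⁻ x, h x) ^ n := by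
  induction n with
  | zero => simp
  | succ n ih =>
    rw [lintegral_fin_succ (by fun_prop)]
    simp only [Fin.prod_univ_succ, Fin.cons_zero, Fin.cons_succ]
    simp_rw [lintegral_const_mul _ (show Measurable fun z : Fin n → X => ∏ k, h (z k) by fun_prop),
      ih]
    rw [lintegral_mul_const _ hh, pow_succ']

/-- The lower bound for weighted densities of transitive tournaments. The induction removes the
source `x 0` and absorbs the factors `w (x 0) _` in the weight. -/
theorem pow_le_transitive_density {w : X → X → ℝ≥0∞} (hw : Measurable (Function.uncurry w))
    (hsum : ∀ x y, w x y + w y x = 1) (n : ℕ) {f : X → ℝ≥0∞} (hf : Measurable f)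
    (hf1 : ∀ x, f x ≤ 1) :
    (∫⁻ x, f x) ^ n ≤ 2 ^ n.choose 2 * ∫⁻ x : Fin n → X, (∏ i, f (x i)) * transProd w x := by
  have hw1 : ∀ x y, w x y ≤ 1 := fun x y => (hsum x y).symm ▸ le_self_add
  induction n generalizing f with
  | zero => simp [transProd]
  | succ n ih =>
    have hm := measurable_transProd hw n
    have hm' := measurable_transProd hw (n + 1)
    have step : ∀ x₀, f x₀ * (∫⁻ x, f x * w x₀ x) ^ n ≤
        2 ^ n.choose 2 * ∫⁻ x : Fin n → X,
          (∏ i, f ((Fin.cons x₀ x : Fin (n + 1) → X) i)) *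
            transProd w (Fin.cons x₀ x : Fin (n + 1) → X) := fun x₀ => by
      have h1 := ih (f := fun x => f x * w x₀ x) (by fun_prop)
        (fun x => mul_le_one' (hf1 x) (hw1 _ _))
      refine (mul_le_mul_right h1 (f x₀)).trans_eq ?_
      rw [mul_left_comm, ← lintegral_const_mul _ (by fun_prop)]
      congr 2 with x
      simp only [Fin.prod_univ_succ, Fin.cons_zero, Fin.cons_succ, transProd_cons,
        Finset.prod_mul_distrib]
      ring
    have step' := lintegral_mono (μ := volume) step
    rw [lintegral_const_mul' _ _ (by simp), ← lintegral_fin_succ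
      (F := fun x : Fin (n + 1) → X => (∏ i, f (x i)) * transProd w x) (by fun_prop)] at step'
    set R := ∫⁻ x : Fin (n + 1) → X, (∏ i, f (x i)) * transProd w x
    set d := ∫⁻ x, f x with hd
    have hd1 : d ≤ 1 := by
      calc d ≤ ∫⁻ _ : X, 1 := lintegral_mono hf1
        _ = 1 := by simp
    have hdt : d ≠ ∞ := (hd1.trans_lt ENNReal.one_lt_top).ne
    -- the edge density with respect to the weight `f` is exactly one half
    have hedge : 2 * ∫⁻ x₀, f x₀ * ∫⁻ x, f x * w x₀ x = d ^ 2 := by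
      have e1 : ∫⁻ x₀, f x₀ * ∫⁻ x, f x * w x₀ x = ∫⁻ x₀, ∫⁻ x, f x₀ * f x * w x₀ x := by
        congr with x₀
        rw [← lintegral_const_mul _ (by fun_prop)]
        simp only [mul_assoc]
      have e2 : ∫⁻ x₀, ∫⁻ x, f x₀ * f x * w x₀ x = ∫⁻ x₀, ∫⁻ x, f x₀ * f x * w x x₀ := by
        rw [lintegral_lintegral_swap (by fun_prop)]
        simp only [mul_comm (f _) (f _)]
      rw [e1, two_mul]
      nth_rw 2 [e2]
      rw [← lintegral_add_left (by fun_prop)]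
      calc _ = ∫⁻ x₀, ∫⁻ x, f x₀ * f x := by
            congr with x₀
            rw [← lintegral_add_left (by fun_prop)]
            simp only [← mul_add, hsum, mul_one]
        _ = d ^ 2 := by
            simp_rw [lintegral_const_mul _ hf]
            rw [lintegral_mul_const _ hf, sq]
    rcases n with _ | m
    · simpa using step'
    · rcases eq_or_ne d 0 with h0 | h0
      · simp [h0]
      · have hJ := pow_lintegral_mul_le (μ := (volume : Measure X)) m hf
          (h := fun x₀ => ∫⁻ x, f x * w x₀ x) (by fun_prop)
        have h2 : d ^ m * d ^ (m + 1 + 1) ≤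
            d ^ m * (2 ^ (m + 1 + 1).choose 2 * R) := by
          calc d ^ m * d ^ (m + 1 + 1) = (d ^ 2) ^ (m + 1) := by ring
            _ = 2 ^ (m + 1) * (∫⁻ x₀, f x₀ * ∫⁻ x, f x * w x₀ x) ^ (m + 1) := by
                rw [← hedge, mul_pow]
            _ ≤ 2 ^ (m + 1) * (d ^ m * (2 ^ (m + 1).choose 2 * R)) := by
                gcongr
                exact hJ.trans (by gcongr)
            _ = _ := by
                rw [show (m + 1 + 1).choose 2 = (m + 1) + (m + 1).choose 2 by
                  rw [Nat.choose_succ_succ' (m + 1) 1, Nat.choose_one_right], pow_add]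
                ring
        exact (ENNReal.mul_le_mul_iff_right (pow_ne_zero _ h0) (ENNReal.pow_ne_top hdt)).1 h2

/-- Inside a transitive tournament all edges may be dropped at the cost of a factor `2` each. -/
theorem lintegral_prod_le_transProd {w : X → X → ℝ≥0∞} (hw : Measurable (Function.uncurry w))
    (hsum : ∀ x y, w x y + w y x = 1) (n : ℕ) {f : X → ℝ≥0∞} (hf : Measurable f)
    (hf1 : ∀ x, f x ≤ 1) :
    ∫⁻ x : Fin n → X, ∏ i, f (x i) ≤
      2 ^ n.choose 2 * ∫⁻ x : Fin n → X, (∏ i, f (x i)) * transProd w x :=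
  (lintegral_fin_prod_eq_pow n hf).trans_le (pow_le_transitive_density hw hsum n hf hf1)

/-- The weighted Sidorenko inequality for the complete bipartite graph. -/
theorem pow_le_bipartite_density {w : X → X → ℝ≥0∞} (hw : Measurable (Function.uncurry w))
    (a b : ℕ) {f g : X → ℝ≥0∞} (hf : Measurable f) (hg : Measurable g) :
    (∫⁻ x, ∫⁻ y, f x * w x y * g y) ^ ((a + 1) * (b + 1)) ≤
      (∫⁻ x, f x) ^ ((a + 1) * b) * (∫⁻ y, g y) ^ (a * (b + 1)) *
        ∫⁻ x : Fin (a + 1) → X, ∫⁻ y : Fin (b + 1) → X,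
          (∏ i, f (x i)) * (∏ j, g (y j)) * ∏ i, ∏ j, w (x i) (y j) := by
  set Q := ∫⁻ x : Fin (a + 1) → X, (∏ i, f (x i)) * ∫⁻ y, g y * ∏ i, w (x i) y with hQ
  have hD : ∫⁻ x, ∫⁻ y, f x * w x y * g y = ∫⁻ y, g y * ∫⁻ x, f x * w x y := by
    rw [lintegral_lintegral_swap (by fun_prop)]
    congr with y
    rw [lintegral_mul_const _ (by fun_prop), mul_comm]
  have hQ' : Q = ∫⁻ y, g y * (∫⁻ x, f x * w x y) ^ (a + 1) := by
    calc Q = ∫⁻ x : Fin (a + 1) → X, ∫⁻ y, g y * ∏ i, (f (x i) * w (x i) y) := by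
          rw [hQ]
          congr with x
          rw [← lintegral_const_mul _ (by fun_prop)]
          congr with y
          rw [Finset.prod_mul_distrib]; ring
      _ = _ := by
          rw [lintegral_lintegral_swap (by fun_prop)]
          congr with y
          rw [lintegral_const_mul _ (by fun_prop),
            lintegral_fin_prod_eq_pow _ (h := fun x => f x * w x y) (by fun_prop)]
  have h1 : (∫⁻ x, ∫⁻ y, f x * w x y * g y) ^ (a + 1) ≤ (∫⁻ y, g y) ^ a * Q := by
    rw [hD, hQ']
    exact pow_lintegral_mul_le a hg (by fun_prop)
  have h2 : Q ^ (b + 1) ≤ ((∫⁻ x, f x) ^ (a + 1)) ^ b *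
      ∫⁻ x : Fin (a + 1) → X, ∫⁻ y : Fin (b + 1) → X,
          (∏ i, f (x i)) * (∏ j, g (y j)) * ∏ i, ∏ j, w (x i) (y j) := by
    rw [← lintegral_fin_prod_eq_pow (a + 1) hf]
    refine (pow_lintegral_mul_le b (by fun_prop) (by fun_prop)).trans_eq ?_
    congr 2 with x
    rw [← lintegral_fin_prod_eq_pow (b + 1) (h := fun y => g y * ∏ i, w (x i) y) (by fun_prop),
      ← lintegral_const_mul _ (by fun_prop)]
    congr with y
    rw [Finset.prod_mul_distrib, Finset.prod_comm, mul_assoc]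
  calc _ = ((∫⁻ x, ∫⁻ y, f x * w x y * g y) ^ (a + 1)) ^ (b + 1) := by rw [pow_mul]
    _ ≤ ((∫⁻ y, g y) ^ a * Q) ^ (b + 1) := by gcongr
    _ = ((∫⁻ y, g y) ^ a) ^ (b + 1) * Q ^ (b + 1) := mul_pow _ _ _
    _ ≤ ((∫⁻ y, g y) ^ a) ^ (b + 1) * _ := mul_le_mul_right h2 _
    _ = _ := by ring

end Kernel

/-! ### Blow-ups of the cyclic triangle -/

/-- The contribution to a homomorphism density of the edges from one part of a blow-up, mapped
to `x`, to another part, mapped to `y`. -/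
noncomputable def crossProd {X : Type*} (w : X → X → ℝ≥0∞) {m n : ℕ} (x : Fin m → X)
    (y : Fin n → X) : ℝ≥0∞ :=
  ∏ i, ∏ j, w (x i) (y j)

section Blowup

variable {X : Type*} [MeasureSpace X] [IsProbabilityMeasure (volume : Measure X)]

/-- The lower bound for the density of the blow-up of the cyclic triangle. The `K_{a,b}` between
the first two parts is bounded below for each position `z` of the third part; the resulting
bound is averaged over `z` by Hölder's inequality. Regularity enters through the co-degree
`κ x y`, which is symmetric. -/
theorem pow_le_cyclicBlowup_density {w : X → X → ℝ≥0∞} (hw : Measurable (Function.uncurry w))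
    (hsum : ∀ x y, w x y + w y x = 1) (hreg : ∀ᵐ x, ∫⁻ y, w x y = 2⁻¹) (a b c : ℕ) :
    2⁻¹ ^ ((a + 1) * (b + 1) + (b + 1) * c + c * (a + 1)) ≤
      ∫⁻ z : Fin c → X, ∫⁻ x : Fin (a + 1) → X, ∫⁻ y : Fin (b + 1) → X,
        crossProd w x y * crossProd w y z * crossProd w z x := by
  have hw1 : ∀ x y, w x y ≤ 1 := fun x y => (hsum x y).symm ▸ le_self_add
  -- in-degrees are one half as well
  have hreg' : ∀ᵐ x, ∫⁻ y, w y x = 2⁻¹ := by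
    filter_upwards [hreg] with x hx
    have h1 : (∫⁻ y, w x y) + ∫⁻ y, w y x = 1 := by
      rw [← lintegral_add_left (by fun_prop)]
      simp [hsum]
    rw [hx, ← ENNReal.inv_two_add_inv_two] at h1
    exact (ENNReal.add_right_inj (by simp)).1 h1
  -- `F z`, `G z` measure the common out- and in-neighborhood of `z`, with edge mass `D z` and
  -- `K_{a+1,b+1}` mass `P z` from the former to the latter
  set f : (Fin c → X) → X → ℝ≥0∞ := fun z x => ∏ k, w (z k) x with hf
  set g : (Fin c → X) → X → ℝ≥0∞ := fun z y => ∏ k, w y (z k) with hg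
  set κ : X → X → ℝ≥0∞ := fun x y => ∫⁻ t, w y t * w t x with hκ
  set F : (Fin c → X) → ℝ≥0∞ := fun z => ∫⁻ x, f z x with hF
  set G : (Fin c → X) → ℝ≥0∞ := fun z => ∫⁻ y, g z y with hG
  set D : (Fin c → X) → ℝ≥0∞ := fun z => ∫⁻ x, ∫⁻ y, f z x * w x y * g z y with hD
  set P : (Fin c → X) → ℝ≥0∞ := fun z =>
    ∫⁻ x : Fin (a + 1) → X, ∫⁻ y : Fin (b + 1) → X,
      (∏ i, f z (x i)) * (∏ j, g z (y j)) * ∏ i, ∏ j, w (x i) (y j) with hP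
  have hfm : Measurable (Function.uncurry f) := by
    simp only [hf, Function.uncurry_def]; fun_prop
  have hgm : Measurable (Function.uncurry g) := by
    simp only [hg, Function.uncurry_def]; fun_prop
  have hκm : Measurable (Function.uncurry κ) := by
    simp only [hκ, Function.uncurry_def]; fun_prop
  have hFm : Measurable F := by fun_prop
  have hGm : Measurable G := by fun_prop
  have hPm : Measurable P := by fun_prop
  have hPint : ∫⁻ z, P z = ∫⁻ z : Fin c → X, ∫⁻ x : Fin (a + 1) → X, ∫⁻ y : Fin (b + 1) → X,
        crossProd w x y * crossProd w y z * crossProd w z x := by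
    refine lintegral_congr fun z => lintegral_congr fun x => lintegral_congr fun y => ?_
    simp only [hf, hg, crossProd]
    rw [Finset.prod_comm (f := fun i k => w (z k) (x i))]
    ring
  have hFint : ∫⁻ z, F z = 2⁻¹ ^ c := by
    rw [hF, lintegral_lintegral_swap (by fun_prop)]
    have : ∀ᵐ x, ∫⁻ z, f z x = 2⁻¹ ^ c := by
      filter_upwards [hreg'] with x hx
      rw [← hx]
      exact lintegral_fin_prod_eq_pow c (h := fun t => w t x) (by fun_prop)
    rw [lintegral_congr_ae this]; simp
  have hGint : ∫⁻ z, G z = 2⁻¹ ^ c := by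
    rw [hG, lintegral_lintegral_swap (by fun_prop)]
    have : ∀ᵐ x, ∫⁻ z, g z x = 2⁻¹ ^ c := by
      filter_upwards [hreg] with x hx
      rw [← hx]
      exact lintegral_fin_prod_eq_pow c (h := fun t => w x t) (by fun_prop)
    rw [lintegral_congr_ae this]; simp
  have hfg : ∀ x y, ∫⁻ z, f z x * g z y = κ x y ^ c := fun x y => by
    rw [hκ, ← lintegral_fin_prod_eq_pow c (h := fun t => w y t * w t x) (by fun_prop)]
    congr with z
    rw [Finset.prod_mul_distrib, mul_comm]
  have hFGint : ∫⁻ z, F z * G z = ∫⁻ x, ∫⁻ y, κ x y ^ c := by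
    calc _ = ∫⁻ z, ∫⁻ x, ∫⁻ y, f z x * g z y := by
          congr with z
          rw [← lintegral_mul_const _ (by fun_prop)]
          congr with x
          rw [← lintegral_const_mul _ (by fun_prop)]
      _ = ∫⁻ x, ∫⁻ y, ∫⁻ z, f z x * g z y := by
          rw [lintegral_lintegral_swap (by fun_prop)]
          congr with x
          rw [lintegral_lintegral_swap (by fun_prop)]
      _ = _ := by simp_rw [hfg]
  have hDint : ∫⁻ z, D z = ∫⁻ x, ∫⁻ y, w x y * κ x y ^ c := by
    rw [hD, lintegral_lintegral_swap (by fun_prop)]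
    congr with x
    rw [lintegral_lintegral_swap (by fun_prop)]
    congr with y
    rw [← hfg, ← lintegral_const_mul _ (by fun_prop)]
    congr with z
    ring
  -- `κ x y` is one half minus the common in-degree of `x` and `y`
  have hκsymm : ∀ᵐ x, ∀ᵐ y, κ x y = κ y x := by
    have aux : ∀ x y, ∫⁻ t, w t x = 2⁻¹ → κ x y + ∫⁻ t, w t y * w t x = 2⁻¹ := fun x y hx => by
      rw [hκ, ← lintegral_add_left (by fun_prop), ← hx]
      congr with t
      rw [← add_mul, hsum, one_mul]
    filter_upwards [hreg'] with x hx
    filter_upwards [hreg'] with y hy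
    have h1 := aux x y hx
    have h2 := aux y x hy
    simp only [mul_comm (w _ x)] at h2
    rw [← h2] at h1
    refine (ENNReal.add_left_inj (ne_top_of_le_ne_top (b := 2⁻¹) (by simp) ?_)).1 h1
    exact h2 ▸ le_add_self
  -- exchanging `x` and `y` preserves `κ` and turns `w x y` into `1 - w x y`
  have hDFG : 2 * ∫⁻ z, D z = ∫⁻ z, F z * G z := by
    have hswap : ∫⁻ x, ∫⁻ y, w x y * κ x y ^ c = ∫⁻ x, ∫⁻ y, w y x * κ x y ^ c := by
      rw [lintegral_lintegral_swap (by fun_prop)]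
      refine lintegral_congr_ae ?_
      filter_upwards [hκsymm] with x hx
      refine lintegral_congr_ae ?_
      filter_upwards [hx] with y hy
      rw [hy]
    rw [hDint, hFGint, two_mul]
    nth_rw 2 [hswap]
    rw [← lintegral_add_left (by fun_prop)]
    congr with x
    rw [← lintegral_add_left (by fun_prop)]
    simp only [← add_mul, hsum, one_mul]
  set M := ∫⁻ z, F z * G z with hM
  have hM4 : 4⁻¹ ^ c ≤ M := by
    have hκint : ∫⁻ x, ∫⁻ y, κ x y = 4⁻¹ := by
      calc _ = ∫⁻ x, ∫⁻ t, (∫⁻ y, w y t) * w t x := by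
            congr with x
            rw [hκ, lintegral_lintegral_swap (by fun_prop)]
            congr with t
            rw [lintegral_mul_const _ (by fun_prop)]
        _ = ∫⁻ x, ∫⁻ t, 2⁻¹ * w t x := by
            congr with x
            refine lintegral_congr_ae ?_
            filter_upwards [hreg'] with t ht
            rw [ht]
        _ = ∫⁻ x : X, 2⁻¹ * 2⁻¹ := by
            refine lintegral_congr_ae ?_
            filter_upwards [hreg'] with x hx
            rw [lintegral_const_mul _ (by fun_prop), hx]
        _ = 4⁻¹ := by
            rw [lintegral_const, measure_univ, mul_one, ← ENNReal.mul_inv (by simp) (by simp)]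
            norm_num
    rcases c with _ | c
    · simp [hM, hF, hG, hf, hg]
    · rw [hFGint, ← hκint, ← lintegral_prod (fun q : X × X => κ q.1 q.2) (by fun_prop)]
      have hJ := pow_lintegral_mul_le (μ := (volume : Measure X).prod volume) c
        (p := fun _ => 1) measurable_const hκm
      rw [← lintegral_prod (f := fun q : X × X => κ q.1 q.2 ^ (c + 1)) (by fun_prop)]
      simpa [Function.uncurry_def] using hJ
  have hMt : M ≠ ∞ := by
    have : M ≤ 1 := by
      rw [hFGint]
      calc ∫⁻ x, ∫⁻ y, κ x y ^ c ≤ ∫⁻ _ : X, ∫⁻ _ : X, 1 := by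
            refine lintegral_mono fun x => lintegral_mono fun y => pow_le_one₀ zero_le ?_
            calc κ x y ≤ ∫⁻ _ : X, 1 := lintegral_mono fun t => mul_le_one' (hw1 _ _) (hw1 _ _)
              _ = 1 := by simp
        _ = 1 := by simp
    exact (this.trans_lt ENNReal.one_lt_top).ne
  have hM0 : M ≠ 0 := fun h => by simp [h] at hM4
  -- Hölder needs total exponent `(a + 1) * (b + 1)`, less than that of the bipartite bound; the
  -- excess is saved by counting `F * G`, whose integral equals that of `2 * D`, as one function
  have hH := pow_lintegral_le_of_pow_le (μ := (volume : Measure (Fin c → X)))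
    (N := (a + 1) * (b + 1)) (by positivity) (D := D) (f := ![P, F, G, fun z => F z * G z])
    (k := ![1, b, a, a * b]) (by intro i; fin_cases i <;> simp <;> fun_prop)
    (by simp [Fin.sum_univ_four]; ring)
    (fun z => by
      refine (pow_le_bipartite_density hw a b (f := f z) (g := g z)
        (by fun_prop) (by fun_prop)).trans_eq ?_
      simp only [Fin.prod_univ_four, Matrix.cons_val]
      ring)
  simp only [Fin.prod_univ_four, Matrix.cons_val, hFint, hGint, hPint, ← hM, pow_one] at hH
  set t := ∫⁻ z : Fin c → X, ∫⁻ x : Fin (a + 1) → X, ∫⁻ y : Fin (b + 1) → X,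
        crossProd w x y * crossProd w y z * crossProd w z x
  have hpow : M ^ (a * b) * (2⁻¹ ^ (2 * c * (a + b + 1))) ≤
      M ^ (a * b) * (2 ^ ((a + 1) * (b + 1)) * t * 2⁻¹ ^ (c * (a + b))) := by
    calc _ = M ^ (a * b) * (4⁻¹ ^ c) ^ (a + b + 1) := by
          rw [← pow_mul, mul_assoc 2 c, pow_mul _ 2]
          congr 2
          rw [sq, ← ENNReal.mul_inv (by simp) (by simp)]; norm_num
      _ ≤ M ^ (a * b) * M ^ (a + b + 1) := by gcongr
      _ = 2 ^ ((a + 1) * (b + 1)) * (∫⁻ z, D z) ^ ((a + 1) * (b + 1)) := by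
          rw [← mul_pow 2, hDFG, ← pow_add]; ring
      _ ≤ 2 ^ ((a + 1) * (b + 1)) * _ := mul_le_mul_right hH _
      _ = _ := by ring
  have hpow' := (ENNReal.mul_le_mul_iff_right (pow_ne_zero _ hM0) (ENNReal.pow_ne_top hMt)).1 hpow
  have h2 : (2 : ℝ≥0∞)⁻¹ * 2 = 1 := ENNReal.inv_mul_cancel (by simp) (by simp)
  refine (ENNReal.mul_le_mul_iff_right (a := 2⁻¹ ^ (c * (a + b)) * 2 ^ ((a + 1) * (b + 1)))
    (by simp) (ENNReal.mul_ne_top (by simp) (by simp))).1 ?_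
  calc _ = ((2 : ℝ≥0∞)⁻¹ * 2) ^ ((a + 1) * (b + 1)) * 2⁻¹ ^ (2 * c * (a + b + 1)) := by ring
    _ ≤ 2 ^ ((a + 1) * (b + 1)) * t * 2⁻¹ ^ (c * (a + b)) := by
        rw [h2, one_pow, one_mul]; exact hpow'
    _ = _ := by ring

/-- The lower bound for the density of `T[a + 1, b + 1, c]`: the edges inside the parts are dropped
one part after the other. -/
theorem pow_le_cyclicBlowupTournament_density {w : X → X → ℝ≥0∞}
    (hw : Measurable (Function.uncurry w)) (hsum : ∀ x y, w x y + w y x = 1)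
    (hreg : ∀ᵐ x, ∫⁻ y, w x y = 2⁻¹) (a b c : ℕ) :
    2⁻¹ ^ ((a + 1) * (b + 1) + (b + 1) * c + c * (a + 1)) ≤
      2 ^ ((a + 1).choose 2 + (b + 1).choose 2 + c.choose 2) *
      ∫⁻ x : Fin (a + 1) → X, ∫⁻ y : Fin (b + 1) → X, ∫⁻ z : Fin c → X,
        crossProd w x y * crossProd w y z * crossProd w z x *
          (transProd w x * transProd w y * transProd w z) := by
  have hw1 : ∀ x y, w x y ≤ 1 := fun x y => (hsum x y).symm ▸ le_self_add
  have hT := measurable_transProd hw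
  have hC : ∀ m n, Measurable (Function.uncurry (crossProd w : (Fin m → X) → (Fin n → X) → _)) :=
    fun m n => by simp only [crossProd, Function.uncurry_def]; fun_prop
  have hTa := hT (a + 1)
  have hTb := hT (b + 1)
  have hTc := hT c
  have hCab := hC (a + 1) (b + 1)
  have hCbc := hC (b + 1) c
  have hCca := hC c (a + 1)
  -- by cyclic symmetry it suffices to know how to drop the edges inside the first part
  have drop : ∀ (l m n : ℕ) (y : Fin m → X) (z : Fin n → X),
      ∫⁻ x : Fin l → X, crossProd w x y * crossProd w y z * crossProd w z x ≤
        2 ^ l.choose 2 * ∫⁻ x : Fin l → X,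
          crossProd w x y * crossProd w y z * crossProd w z x * transProd w x := by
    intro l m n y z
    have hTl := hT l
    have h := lintegral_prod_le_transProd hw hsum l
      (f := fun t => (∏ j, w t (y j)) * ∏ k, w (z k) t) (by fun_prop)
      (fun t => mul_le_one' (Finset.prod_le_one' fun _ _ => hw1 _ _)
        (Finset.prod_le_one' fun _ _ => hw1 _ _))
    have e : ∀ x : Fin l → X, crossProd w x y * crossProd w y z * crossProd w z x =
        crossProd w y z * ∏ i, ((∏ j, w (x i) (y j)) * ∏ k, w (z k) (x i)) := fun x => by
      rw [Finset.prod_mul_distrib, crossProd, crossProd, crossProd,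
        Finset.prod_comm (f := fun k i => w (z k) (x i))]
      ring
    simp only [e, mul_assoc (crossProd w y z)]
    rw [lintegral_const_mul _ (by fun_prop), lintegral_const_mul _ (by fun_prop), mul_left_comm]
    exact mul_le_mul_right h _
  calc _ ≤ ∫⁻ z : Fin c → X, ∫⁻ x : Fin (a + 1) → X, ∫⁻ y : Fin (b + 1) → X,
        crossProd w x y * crossProd w y z * crossProd w z x :=
        pow_le_cyclicBlowup_density hw hsum hreg a b c
    _ = ∫⁻ y : Fin (b + 1) → X, ∫⁻ z : Fin c → X, ∫⁻ x : Fin (a + 1) → X,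
        crossProd w x y * crossProd w y z * crossProd w z x := by
        rw [lintegral_congr fun z => lintegral_lintegral_swap (f := fun x y =>
          crossProd w x y * crossProd w y z * crossProd w z x) (by fun_prop)]
        exact lintegral_lintegral_swap (by fun_prop)
    _ ≤ ∫⁻ y : Fin (b + 1) → X, ∫⁻ z : Fin c → X, 2 ^ (a + 1).choose 2 *
          ∫⁻ x : Fin (a + 1) → X,
            crossProd w x y * crossProd w y z * crossProd w z x * transProd w x := by
        gcongr with y z
        exact drop _ _ _ _ _
    _ = 2 ^ (a + 1).choose 2 * ∫⁻ x : Fin (a + 1) → X, transProd w x *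
          ∫⁻ z : Fin c → X, ∫⁻ y : Fin (b + 1) → X,
            crossProd w y z * crossProd w z x * crossProd w x y := by
        simp_rw [lintegral_const_mul' _ _ (show (2 : ℝ≥0∞) ^ (a + 1).choose 2 ≠ ∞ by simp)]
        congr 1
        rw [lintegral_congr fun y => lintegral_lintegral_swap (f := fun z x =>
            crossProd w x y * crossProd w y z * crossProd w z x * transProd w x) (by fun_prop),
          lintegral_lintegral_swap (by fun_prop)]
        refine lintegral_congr fun x => ?_
        rw [lintegral_lintegral_swap (by fun_prop), ← lintegral_const_mul _ (by fun_prop)]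
        refine lintegral_congr fun z => ?_
        rw [← lintegral_const_mul _ (by fun_prop)]
        refine lintegral_congr fun y => ?_
        ring
    _ ≤ 2 ^ (a + 1).choose 2 * ∫⁻ x : Fin (a + 1) → X, transProd w x *
          ∫⁻ z : Fin c → X, 2 ^ (b + 1).choose 2 * ∫⁻ y : Fin (b + 1) → X,
            crossProd w y z * crossProd w z x * crossProd w x y * transProd w y := by
        gcongr with x z
        exact drop _ _ _ _ _
    _ = 2 ^ (a + 1).choose 2 * 2 ^ (b + 1).choose 2 * ∫⁻ x : Fin (a + 1) → X,
          ∫⁻ y : Fin (b + 1) → X, transProd w x * transProd w y *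
            ∫⁻ z : Fin c → X, crossProd w z x * crossProd w x y * crossProd w y z := by
        simp_rw [lintegral_const_mul' _ _ (show (2 : ℝ≥0∞) ^ (b + 1).choose 2 ≠ ∞ by simp),
          mul_left_comm _ ((2 : ℝ≥0∞) ^ (b + 1).choose 2)]
        rw [lintegral_const_mul' _ _ (by simp), ← mul_assoc]
        congr 1
        refine lintegral_congr fun x => ?_
        rw [lintegral_lintegral_swap (by fun_prop), ← lintegral_const_mul _ (by fun_prop)]
        refine lintegral_congr fun y => ?_
        rw [← lintegral_const_mul _ (by fun_prop), ← lintegral_const_mul _ (by fun_prop)]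
        refine lintegral_congr fun z => ?_
        ring
    _ ≤ 2 ^ (a + 1).choose 2 * 2 ^ (b + 1).choose 2 * ∫⁻ x : Fin (a + 1) → X,
          ∫⁻ y : Fin (b + 1) → X, transProd w x * transProd w y *
            (2 ^ c.choose 2 * ∫⁻ z : Fin c → X,
              crossProd w z x * crossProd w x y * crossProd w y z * transProd w z) := by
        gcongr with x y
        exact drop _ _ _ _ _
    _ = _ := by
        simp_rw [mul_left_comm _ (2 ^ c.choose 2 : ℝ≥0∞)]
        simp_rw [lintegral_const_mul' _ _ (show (2 : ℝ≥0∞) ^ c.choose 2 ≠ ∞ by simp)]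
        rw [← mul_assoc, ← pow_add, ← pow_add]
        congr 1
        refine lintegral_congr fun x => lintegral_congr fun y => ?_
        rw [← lintegral_const_mul _ (by fun_prop)]
        refine lintegral_congr fun z => ?_
        ring

end Blowup

/-! ### Homomorphism densities of digraphs -/

section Density

variable {X : Type*} [MeasureSpace X]

open Classical in
/-- The homomorphism density of the digraph with edge relation `r` in the kernel `w`, as an
extended nonnegative real. -/
noncomputable def relDensity {ι : Type*} [Fintype ι] (w : X → X → ℝ≥0∞) (r : ι → ι → Prop) :
    ℝ≥0∞ :=
  ∫⁻ x : ι → X, ∏ u, ∏ v, if r u v then w (x u) (x v) else 1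

open Classical in
theorem measurable_prod_ite {ι : Type*} [Fintype ι] {w : X → X → ℝ≥0∞}
    (hw : Measurable (Function.uncurry w)) (r : ι → ι → Prop) :
    Measurable fun x : ι → X => ∏ u, ∏ v, if r u v then w (x u) (x v) else 1 := by
  refine Finset.measurable_prod _ fun i _ => Finset.measurable_prod _ fun j _ => ?_
  split_ifs <;> fun_prop

theorem relDensity_congr [SigmaFinite (volume : Measure X)] {ι κ : Type*} [Fintype ι] [Fintype κ]
    {w : X → X → ℝ≥0∞} (hw : Measurable (Function.uncurry w)) {r : ι → ι → Prop}
    {s : κ → κ → Prop} (e : ι ≃ κ) (h : ∀ u v, r u v ↔ s (e u) (e v)) :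
    relDensity w r = relDensity w s := by
  classical
  unfold relDensity
  rw [← (volume_measurePreserving_piCongrLeft (fun _ : κ => X) e).lintegral_comp
    (measurable_prod_ite hw s)]
  refine lintegral_congr fun x => ?_
  have hx : ∀ u, MeasurableEquiv.piCongrLeft (fun _ : κ => X) e x (e u) = x u := fun u =>
    Equiv.piCongrLeft_apply_apply (P := fun _ : κ => X) e x u
  rw [← Equiv.prod_comp e]
  refine Finset.prod_congr rfl fun u _ => ?_
  rw [← Equiv.prod_comp e]
  refine Finset.prod_congr rfl fun v _ => ?_
  simp only [hx, h]

theorem pow_le_relDensity_lt [IsProbabilityMeasure (volume : Measure X)] {w : X → X → ℝ≥0∞}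
    (hw : Measurable (Function.uncurry w)) (hsum : ∀ x y, w x y + w y x = 1) (n : ℕ) :
    2⁻¹ ^ n.choose 2 ≤ relDensity w (fun i j : Fin n => i < j) := by
  have h := pow_le_transitive_density hw hsum n (f := fun _ => 1) measurable_const
    (fun _ => le_rfl)
  simp only [lintegral_const, measure_univ, mul_one, one_pow, Finset.prod_const_one,
    one_mul] at h
  have h' : ∫⁻ x : Fin n → X, transProd w x = relDensity w (fun i j : Fin n => i < j) := by
    unfold relDensity transProd
    congr!
  rw [← h', ← ENNReal.inv_pow]
  exact ENNReal.inv_le_iff_le_mul (by simp) (by simp) |>.2 h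

/-- The vertices of the blow-up as a disjoint union of its three parts. -/
def sumToBlowup (a b c : ℕ) : Fin a ⊕ (Fin b ⊕ Fin c) → BlowupVertex a b c
  | Sum.inl i => ⟨0, i⟩
  | Sum.inr (Sum.inl j) => ⟨1, j⟩
  | Sum.inr (Sum.inr k) => ⟨2, k⟩

theorem sumToBlowup_bijective (a b c : ℕ) : Function.Bijective (sumToBlowup a b c) := by
  constructor
  · rintro (i | i | i) (j | j | j) h
    all_goals
      first
      | rw [eq_of_heq (Sigma.mk.inj_iff.1 h).2]
      | exact absurd (congrArg Sigma.fst h) (by simp [sumToBlowup])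
  · rintro ⟨p, i⟩
    fin_cases p
    · exact ⟨Sum.inl i, rfl⟩
    · exact ⟨Sum.inr (Sum.inl i), rfl⟩
    · exact ⟨Sum.inr (Sum.inr i), rfl⟩

/-- Fubini's theorem for the three parts of `T[a,b,c]`. -/
theorem relDensity_cyclicBlowupTournament [IsProbabilityMeasure (volume : Measure X)]
    {w : X → X → ℝ≥0∞} (hw : Measurable (Function.uncurry w)) (a b c : ℕ) :
    relDensity w (cyclicBlowupTournament a b c).Adj =
      ∫⁻ x : Fin a → X, ∫⁻ y : Fin b → X, ∫⁻ z : Fin c → X,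
        crossProd w x y * crossProd w y z * crossProd w z x *
          (transProd w x * transProd w y * transProd w z) := by
  classical
  rw [← relDensity_congr hw (Equiv.ofBijective _ (sumToBlowup_bijective a b c))
    (r := fun u v => (cyclicBlowupTournament a b c).Adj (sumToBlowup a b c u)
      (sumToBlowup a b c v)) (fun _ _ => Iff.rfl)]
  unfold relDensity
  have hm := measurable_prod_ite hw (fun u v => (cyclicBlowupTournament a b c).Adj
      (sumToBlowup a b c u) (sumToBlowup a b c v))
  rw [← (volume_measurePreserving_sumPiEquivProdPi_symm
    (fun _ : Fin a ⊕ (Fin b ⊕ Fin c) => X)).lintegral_comp hm, Measure.volume_eq_prod,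
    lintegral_prod _ (by exact (hm.comp (MeasurableEquiv.measurable _)).aemeasurable)]
  refine lintegral_congr fun x => ?_
  rw [← (volume_measurePreserving_sumPiEquivProdPi_symm
    (fun _ : Fin b ⊕ Fin c => X)).lintegral_comp, Measure.volume_eq_prod, lintegral_prod]
  · refine lintegral_congr fun y => lintegral_congr fun z => ?_
    have hl : ∀ {α β : Type} [Fintype α] [Fintype β] (p : α → X) (q : β → X) (i : α),
        (MeasurableEquiv.sumPiEquivProdPi fun _ : α ⊕ β => X).symm (p, q) (Sum.inl i) = p i :=
      fun _ _ _ => rfl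
    have hr : ∀ {α β : Type} [Fintype α] [Fintype β] (p : α → X) (q : β → X) (i : β),
        (MeasurableEquiv.sumPiEquivProdPi fun _ : α ⊕ β => X).symm (p, q) (Sum.inr i) = q i :=
      fun _ _ _ => rfl
    simp only [Fintype.prod_sum_type, hl, hr]
    simp [cyclicBlowupTournament, cyclicBlowup, sumToBlowup, crossProd, transProd,
      Finset.prod_mul_distrib]
    ring
  · exact ((hm.comp (MeasurableEquiv.measurable _)).comp measurable_prodMk_left).comp
      (MeasurableEquiv.measurable _) |>.aemeasurable
  · exact (hm.comp (MeasurableEquiv.measurable _)).comp measurable_prodMk_left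

end Density

theorem ofReal_homDensity {V : Type*} [Fintype V] (H : Digraph V) (W : Tournamenton) :
    ENNReal.ofReal (homDensity H W) =
      relDensity (fun x y => ENNReal.ofReal (W.toFun x y)) H.Adj := by
  classical
  have hm : Measurable (Function.uncurry W.toFun) := W.measurable'
  have hnn : ∀ x : V → I, 0 ≤ ∏ e ∈ H.edgeFinset, W.toFun (x e.1) (x e.2) := fun x =>
    Finset.prod_nonneg fun e _ => (W.mem_Icc' _ _).1
  unfold homDensity relDensity
  rw [ofReal_integral_eq_lintegral_ofReal]
  · refine lintegral_congr fun x => ?_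
    rw [ENNReal.ofReal_prod_of_nonneg fun e _ => (W.mem_Icc' _ _).1, Digraph.edgeFinset,
      Finset.prod_filter, ← Finset.univ_product_univ, Finset.prod_product]
  · refine Integrable.of_bound (C := 1) (Measurable.aestronglyMeasurable ?_)
      (Filter.Eventually.of_forall fun x => ?_)
    · exact Finset.measurable_prod _ fun e _ => by fun_prop
    rw [Real.norm_of_nonneg (hnn x)]
    exact Finset.prod_le_one (fun e _ => (W.mem_Icc' _ _).1) fun e _ => (W.mem_Icc' _ _).2
  · exact Filter.Eventually.of_forall hnn

theorem Tournamenton.ofReal_sum (W : Tournamenton) (x y : I) :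
    ENNReal.ofReal (W.toFun x y) + ENNReal.ofReal (W.toFun y x) = 1 := by
  rw [← ENNReal.ofReal_add (W.mem_Icc' _ _).1 (W.mem_Icc' _ _).1, W.add_swap', ENNReal.ofReal_one]

theorem Tournamenton.IsRegular.lintegral_eq {W : Tournamenton} (hW : W.IsRegular) :
    ∀ᵐ x : I, ∫⁻ y : I, ENNReal.ofReal (W.toFun x y) = 2⁻¹ := by
  have hm : Measurable (Function.uncurry W.toFun) := W.measurable'
  filter_upwards [hW] with x hx
  rw [← ofReal_integral_eq_lintegral_ofReal, hx]
  · rw [one_div, ENNReal.ofReal_inv_of_pos (by norm_num)]; norm_num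
  · refine Integrable.of_bound (C := 1) (by fun_prop) (Filter.Eventually.of_forall fun y => ?_)
    rw [Real.norm_of_nonneg (W.mem_Icc' _ _).1]
    exact (W.mem_Icc' _ _).2
  · exact Filter.Eventually.of_forall fun y => (W.mem_Icc' _ _).1

theorem zpow_le_homDensity_of_relDensity {V : Type*} [Fintype V] {H : Digraph V}
    {W : Tournamenton} {N : ℕ}
    (h : 2⁻¹ ^ N ≤ relDensity (fun x y => ENNReal.ofReal (W.toFun x y)) H.Adj) :
    homDensity H W ≥ (2 : ℝ) ^ (-(N : ℤ)) := by
  rw [← ofReal_homDensity] at h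
  have h2 : (2⁻¹ : ℝ≥0∞) ^ N = ENNReal.ofReal ((2 : ℝ) ^ (-(N : ℤ))) := by
    rw [zpow_neg, zpow_natCast, ← inv_pow, ENNReal.ofReal_pow (by norm_num),
      ENNReal.ofReal_inv_of_pos (by norm_num)]
    norm_num
  rw [h2] at h
  by_contra! hlt
  exact absurd h (not_le.2 ((ENNReal.ofReal_lt_ofReal_iff (by positivity)).2 hlt))

/-- A strict total order on a finite type is the standard order of some `Fin n`. -/
theorem exists_equiv_fin_lt {V : Type*} [Fintype V] {r : V → V → Prop} (hirr : ∀ v, ¬ r v v)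
    (htot : ∀ u v, u ≠ v → r u v ∨ r v u) (htrans : ∀ u v w, r u v → r v w → r u w) {n : ℕ}
    (hn : Fintype.card V = n) : ∃ e : V ≃ Fin n, ∀ u v, r u v ↔ e u < e v := by
  classical
  have : IsStrictTotalOrder V r :=
    { trichotomous := fun u v h1 h2 => by
        by_contra h
        exact (htot u v h).elim h1 h2
      irrefl := hirr
      trans := htrans }
  let _ : LinearOrder V := linearOrderOfSTO r
  exact ⟨(Fintype.orderIsoFinOfCardEq V hn).symm.toEquiv, fun u v =>
    ((Fintype.orderIsoFinOfCardEq V hn).symm.lt_iff_lt).symm⟩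

theorem Digraph.IsTransitiveTournament.le_homDensity {V : Type*} [Fintype V] {T : Digraph V}
    (hT : T.IsTransitiveTournament) (W : Tournamenton) :
    homDensity T W ≥ (2 : ℝ) ^ (-((Fintype.card V).choose 2 : ℤ)) := by
  have hm : Measurable (Function.uncurry W.toFun) := W.measurable'
  obtain ⟨e, he⟩ := exists_equiv_fin_lt hT.1.1 (fun u v h => (hT.1.2 u v h).or) hT.2 rfl
  apply zpow_le_homDensity_of_relDensity
  rw [relDensity_congr (by fun_prop) e he]
  exact pow_le_relDensity_lt (by fun_prop) W.ofReal_sum _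

theorem choose_two_add_add (a b c : ℕ) :
    (a + b + c).choose 2 = a.choose 2 + b.choose 2 + c.choose 2 + (a * b + b * c + c * a) := by
  have h : ∀ m n : ℕ, (m + n).choose 2 = m.choose 2 + n.choose 2 + m * n := fun m n => by
    qify
    simp only [Nat.cast_choose_two, Nat.cast_add]
    ring
  rw [h, h]; ring

theorem le_homDensity_of_isIsomorphic {V : Type*} [Fintype V] {T : Digraph V} {a b c : ℕ}
    (ha : 1 ≤ a) (hb : 1 ≤ b) (hT : T.IsIsomorphic (cyclicBlowupTournament a b c))
    {W : Tournamenton} (hW : W.IsRegular) :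
    homDensity T W ≥ (2 : ℝ) ^ (-((Fintype.card V).choose 2 : ℤ)) := by
  have hm : Measurable (Function.uncurry W.toFun) := W.measurable'
  obtain ⟨e⟩ := hT
  have hcard : Fintype.card V = a + b + c := by
    rw [Fintype.card_congr (e.toEquiv.trans
      (Equiv.ofBijective _ (sumToBlowup_bijective a b c)).symm)]
    simp [add_assoc]
  apply zpow_le_homDensity_of_relDensity
  rw [relDensity_congr (by fun_prop) e.toEquiv (fun u v => e.map_rel_iff.symm),
    relDensity_cyclicBlowupTournament (by fun_prop), hcard, choose_two_add_add, pow_add]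
  obtain ⟨a, rfl⟩ := Nat.exists_eq_add_of_le' ha
  obtain ⟨b, rfl⟩ := Nat.exists_eq_add_of_le' hb
  have h := pow_le_cyclicBlowupTournament_density
    (w := fun x y => ENNReal.ofReal (W.toFun x y)) (by fun_prop) W.ofReal_sum
    hW.lintegral_eq a b c
  refine (mul_le_mul_right h _).trans_eq ?_
  rw [← mul_assoc, ← mul_pow, ENNReal.inv_mul_cancel (by simp) (by simp), one_pow, one_mul]

/-! ### Tournaments and the constant tournamenton -/

theorem Digraph.IsTournament.not_adj_of_adj {V : Type*} {T : Digraph V} (hT : T.IsTournament)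
    {u v : V} (h : T.Adj u v) : ¬ T.Adj v u := by
  rcases eq_or_ne u v with rfl | huv
  · exact hT.1 u
  · rcases hT.2 u v huv with h1 | h1
    · exact h1.2
    · exact absurd h h1.2

theorem Digraph.IsTournament.card_edgeFinset {V : Type*} [Fintype V] {T : Digraph V}
    (hT : T.IsTournament) : T.edgeFinset.card = (Fintype.card V).choose 2 := by
  classical
  have hmem : ∀ e, e ∈ T.edgeFinset ↔ T.Adj e.1 e.2 := fun e => by simp [Digraph.edgeFinset]
  have hdisj : Disjoint T.edgeFinset (T.edgeFinset.map (Equiv.prodComm V V).toEmbedding) := by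
    rw [Finset.disjoint_left]
    rintro ⟨u, v⟩ h1 h2
    simp only [Finset.mem_map_equiv, hmem] at h1 h2
    exact hT.not_adj_of_adj h1 h2
  have hunion : T.edgeFinset ∪ T.edgeFinset.map (Equiv.prodComm V V).toEmbedding =
      (Finset.univ : Finset V).offDiag := by
    ext ⟨u, v⟩
    simp only [Finset.mem_union, Finset.mem_map_equiv, hmem, Finset.mem_offDiag, Finset.mem_univ,
      true_and, Equiv.prodComm_symm, Equiv.prodComm_apply, Prod.swap]
    constructor
    · rintro (h | h) rfl <;> exact hT.1 _ h
    · exact fun h => (hT.2 u v h).or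
  have hc := congrArg Finset.card hunion
  rw [Finset.card_union_of_disjoint hdisj, Finset.card_map, Finset.offDiag_card,
    Finset.card_univ] at hc
  rw [Nat.choose_two_right, Nat.mul_sub, mul_one, ← hc]
  omega

theorem homDensity_half {V : Type*} [Fintype V] {T : Digraph V} (hT : T.IsTournament) :
    homDensity T Tournamenton.half = (2 : ℝ) ^ (-((Fintype.card V).choose 2 : ℤ)) := by
  simp [homDensity, Tournamenton.half, hT.card_edgeFinset]

theorem Digraph.IsTournament.isTransitiveTournament {V : Type*} {T : Digraph V}
    (hT : T.IsTournament) (h : ∀ u v w, T.Adj u v → T.Adj v w → T.Adj w u → False) :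
    T.IsTransitiveTournament := by
  refine ⟨hT, fun u v w huv hvw => ?_⟩
  rcases eq_or_ne u w with rfl | huw
  · exact absurd hvw (hT.not_adj_of_adj huv)
  · exact (hT.2 u w huw).or.resolve_right (h u v w huv hvw)

/-! ### Tournamentons from compact groups -/

section Group

variable {Γ : Type*} [AddCommGroup Γ]

open Classical in
/-- The kernel value attached to a difference `g` of positions in a group with a set `P` of
"positive" elements: `1` on `P`, `0` on `-P`, and `1 / 2` elsewhere. -/
noncomputable def signValue (P : Set Γ) (g : Γ) : ℝ :=
  if g ∈ P then 1 else if -g ∈ P then 0 else 1 / 2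

theorem signValue_mem_Icc (P : Set Γ) (g : Γ) : signValue P g ∈ Set.Icc (0 : ℝ) 1 := by
  unfold signValue
  split_ifs <;> norm_num

theorem signValue_add_neg {P : Set Γ} (hP : ∀ g ∈ P, -g ∉ P) (g : Γ) :
    signValue P g + signValue P (-g) = 1 := by
  unfold signValue
  rw [neg_neg]
  by_cases h1 : g ∈ P
  · simp [h1, hP g h1]
  · by_cases h2 : -g ∈ P <;> simp [h1, h2]
    norm_num

theorem measurable_signValue [MeasurableSpace Γ] [MeasurableNeg Γ] {P : Set Γ}
    (hP : MeasurableSet P) : Measurable (signValue P) :=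
  Measurable.ite hP measurable_const
    (Measurable.ite (measurable_neg hP) measurable_const measurable_const)

/-- The tournamenton obtained by placing the points of the unit interval in a group, with an edge
from `x` to `y` if the difference of their positions lies in `P`. -/
noncomputable def Tournamenton.ofPositive [MeasurableSpace Γ] [MeasurableNeg Γ] [MeasurableSub₂ Γ]
    {P : Set Γ} (hPm : MeasurableSet P) (hP : ∀ g ∈ P, -g ∉ P) {φ : I → Γ} (hφ : Measurable φ) :
    Tournamenton where
  toFun x y := signValue P (φ y - φ x)
  measurable' := by
    have := measurable_signValue hPm
    simp only [Function.uncurry_def]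
    fun_prop
  mem_Icc' _ _ := signValue_mem_Icc _ _
  add_swap' x y := by rw [← signValue_add_neg hP (φ y - φ x), neg_sub]

/-- If invariant probability measure on the group is transported to the unit interval, the
tournamenton of a set `P` with `P ∪ -P` conull is regular, and tournaments of positive density
in it embed in the group. -/
theorem exists_isRegular_of_positive [MeasurableSpace Γ] [MeasurableNeg Γ] [MeasurableAdd₂ Γ]
    [MeasurableSub₂ Γ] [StandardBorelSpace Γ] (μ : Measure Γ) [IsProbabilityMeasure μ]
    [μ.IsAddLeftInvariant] [μ.IsNegInvariant] {P : Set Γ} (hPm : MeasurableSet P)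
    (hP : ∀ g ∈ P, -g ∉ P) (hnull : μ {g | g ∉ P ∧ -g ∉ P} = 0) {V : Type*} [Fintype V] :
    ∃ W : Tournamenton, W.IsRegular ∧ ∀ T : Digraph V, T.IsTournament → homDensity T W ≠ 0 →
      ∃ p : V → Γ, ∀ u v, T.Adj u v → p v - p u ∈ P := by
  obtain ⟨φ, hφ, hmap⟩ := μ.exists_measurable_map_eq
  have hpres : MeasurePreserving φ volume μ := ⟨hφ, hmap⟩
  have hS := measurable_signValue hPm
  refine ⟨Tournamenton.ofPositive hPm hP hφ, Filter.Eventually.of_forall fun x => ?_,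
    fun T hT hne => ?_⟩
  · have hint : Integrable (signValue P) μ :=
      Integrable.of_bound hS.aestronglyMeasurable (C := 1) (Filter.Eventually.of_forall fun g => by
        rw [Real.norm_of_nonneg (signValue_mem_Icc P g).1]; exact (signValue_mem_Icc P g).2)
    have h1 : ∫ y, signValue P (φ y - φ x) = ∫ g, signValue P g ∂μ := by
      rw [← integral_sub_right_eq_self (μ := μ) (signValue P) (φ x), ← hmap,
        integral_map hφ.aemeasurable
          (f := fun g => signValue P (g - φ x))
          (hS.comp (measurable_id.sub_const _)).aestronglyMeasurable]
    have h2 : (∫ g, signValue P g ∂μ) + ∫ g, signValue P g ∂μ = 1 := by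
      nth_rw 2 [← integral_neg_eq_self]
      rw [← integral_add hint hint.comp_neg]
      simp [signValue_add_neg hP]
    change ∫ y, signValue P (φ y - φ x) = 1 / 2
    linarith
  · -- almost surely no difference of positions of two vertices is undecided
    have hties : ∀ᵐ x : V → I, ∀ u v, u ≠ v →
        ¬ (φ (x v) - φ (x u) ∉ P ∧ -(φ (x v) - φ (x u)) ∉ P) := by
      refine ae_all_iff.2 fun u => ae_all_iff.2 fun v => ?_
      by_cases huv : u = v
      · simp [huv]
      have hZm : MeasurableSet {g : Γ | g ∉ P ∧ -g ∉ P} :=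
        hPm.compl.inter (measurable_neg hPm).compl
      have hind : ProbabilityTheory.IndepFun (fun x : V → I => x u) (fun x => x v) volume :=
        (ProbabilityTheory.iIndepFun_pi (μ := fun _ : V => (volume : Measure I))
          (X := fun _ => id) (fun _ => aemeasurable_id)).indepFun huv
      have hlaw := (ProbabilityTheory.indepFun_iff_map_prod_eq_prod_map_map
        (measurable_pi_apply u).aemeasurable (measurable_pi_apply v).aemeasurable).1 hind
      have hev : ∀ w : V, (volume : Measure (V → I)).map (fun x => x w) = volume := fun w =>
        (measurePreserving_eval (fun _ : V => (volume : Measure I)) w).map_eq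
      rw [hev, hev] at hlaw
      have hpair : ∀ᵐ q : I × I ∂(volume.prod volume),
          ¬ (φ q.2 - φ q.1 ∉ P ∧ -(φ q.2 - φ q.1) ∉ P) := by
        have hm : MeasurableSet {q : I × I | φ q.2 - φ q.1 ∉ P ∧ -(φ q.2 - φ q.1) ∉ P} := by
          have : Measurable fun q : I × I => φ q.2 - φ q.1 := by fun_prop
          exact this hZm
        rw [ae_iff]
        simp only [not_not]
        rw [Measure.measure_prod_null hm]
        refine Filter.Eventually.of_forall fun s => ?_
        have h1 : Prod.mk s ⁻¹' {q : I × I | φ q.2 - φ q.1 ∉ P ∧ -(φ q.2 - φ q.1) ∉ P} =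
            φ ⁻¹' ((fun g => g + -φ s) ⁻¹' {g : Γ | g ∉ P ∧ -g ∉ P}) := by
          ext t; simp [sub_eq_add_neg]
        change volume (Prod.mk s ⁻¹' {q : I × I | φ q.2 - φ q.1 ∉ P ∧ -(φ q.2 - φ q.1) ∉ P}) = 0
        rw [h1, hpres.measure_preimage ((measurable_add_const _ hZm).nullMeasurableSet),
          measure_preimage_add_right, hnull]
      rw [← hlaw] at hpair
      have := ae_of_ae_map (by fun_prop) hpair
      filter_upwards [this] with x hx _ using hx
    by_contra! hcon
    refine hne (integral_eq_zero_of_ae ?_)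
    filter_upwards [hties] with x hx
    obtain ⟨u, v, huv, hnot⟩ := hcon (fun v => φ (x v))
    have hne : u ≠ v := fun h => hT.1 v (h ▸ huv)
    have hmem : -(φ (x v) - φ (x u)) ∈ P := by
      by_contra h
      exact hx u v hne ⟨hnot, h⟩
    refine Finset.prod_eq_zero (i := (u, v)) (by simpa [Digraph.edgeFinset] using huv) ?_
    simp only [Tournamenton.ofPositive, signValue]
    rw [if_neg hnot, if_pos hmem]

end Group

/-! ### The circle -/

section Circle

theorem circle_coe_eq {s t : ℝ} (h : (s : UnitAddCircle) = t) : ∃ n : ℤ, (n : ℝ) = s - t := by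
  rw [← sub_eq_zero, ← AddCircle.coe_sub, AddCircle.coe_eq_zero_iff] at h
  simpa using h

/-- The carousel tournamenton: the points lie on a circle, and each one beats the half circle that
follows it. -/
theorem exists_isRegular_circle {V : Type*} [Fintype V] :
    ∃ W : Tournamenton, W.IsRegular ∧ ∀ T : Digraph V, T.IsTournament → homDensity T W ≠ 0 →
      ∃ p : V → UnitAddCircle, ∀ u v, T.Adj u v →
        p v - p u ∈ ((↑) : ℝ → UnitAddCircle) '' Set.Ioo 0 (1 / 2) := by
  have : IsProbabilityMeasure (volume : Measure UnitAddCircle) := ⟨UnitAddCircle.measure_univ⟩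
  have : Nontrivial UnitAddCircle := ⟨((1 / 2 : ℝ) : UnitAddCircle), (0 : ℝ), fun h => by
    obtain ⟨n, hn⟩ := circle_coe_eq h
    have h0 : (0 : ℝ) < n := by linarith
    have h1 : (n : ℝ) < 1 := by linarith
    norm_cast at h0 h1
    omega⟩
  have : Filter.NeBot (nhdsWithin (0 : UnitAddCircle) {0}ᶜ) := inferInstance
  refine exists_isRegular_of_positive (volume : Measure UnitAddCircle)
    (QuotientAddGroup.isOpenMap_coe _ isOpen_Ioo).measurableSet ?_ ?_
  · rintro _ ⟨s, ⟨hs0, hs1⟩, rfl⟩ ⟨t, ⟨ht0, ht1⟩, hst⟩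
    obtain ⟨n, hn⟩ := circle_coe_eq (s := t) (t := -s) (by simpa using hst)
    have h0 : (0 : ℝ) < n := by linarith
    have h1 : (n : ℝ) < 1 := by linarith
    norm_cast at h0 h1
    omega
  · refine measure_mono_null (t := {0, ((1 / 2 : ℝ) : UnitAddCircle)}) ?_
      (Set.Finite.measure_zero (by simp) _)
    rintro g ⟨h1, h2⟩
    obtain ⟨t, ⟨ht0, ht1⟩, rfl⟩ : ∃ t ∈ Set.Ico (0 : ℝ) 1, (t : UnitAddCircle) = g := by
      have := AddCircle.coe_image_Ico_eq (1 : ℝ) 0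
      rw [zero_add] at this
      have h : g ∈ ((↑) : ℝ → UnitAddCircle) '' Set.Ico 0 1 := this ▸ Set.mem_univ g
      exact h
    rcases ht0.eq_or_lt with rfl | ht0
    · simp
    rcases lt_trichotomy t (1 / 2) with h | rfl | h
    · exact absurd ⟨t, ⟨ht0, h⟩, rfl⟩ h1
    · simp
    · refine absurd ⟨1 - t, ⟨by linarith, by linarith⟩, ?_⟩ h2
      simp

/-- Points in an open half circle are linearly ordered. -/
theorem circle_lt {s t : ℝ} (hs : s ∈ Set.Ioo (0 : ℝ) (1 / 2)) (ht : t ∈ Set.Ioo (0 : ℝ) (1 / 2))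
    (h : (t : UnitAddCircle) - s ∈ ((↑) : ℝ → UnitAddCircle) '' Set.Ioo 0 (1 / 2)) : s < t := by
  obtain ⟨r, ⟨hr0, hr1⟩, hr⟩ := h
  obtain ⟨n, hn⟩ := circle_coe_eq (s := r) (t := t - s) (by simpa using hr)
  have h0 : (-1 : ℝ) < n := by linarith [hs.1, ht.2]
  have h1 : (n : ℝ) < 1 := by linarith [hs.2, ht.1]
  have : n = 0 := by
    norm_cast at h1
    have : (-1 : ℤ) < n := by exact_mod_cast h0
    omega
  subst this
  simp only [Int.cast_zero] at hn
  linarith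

/-- A tournament drawn on the circle is locally transitive. -/
theorem no_cycle_in_neighborhood_of_circle {V : Type*} {T : Digraph V} {p : V → UnitAddCircle}
    (hp : ∀ u v, T.Adj u v → p v - p u ∈ ((↑) : ℝ → UnitAddCircle) '' Set.Ioo 0 (1 / 2))
    {u v w z : V} (h : T.Adj z u ∧ T.Adj z v ∧ T.Adj z w ∨ T.Adj u z ∧ T.Adj v z ∧ T.Adj w z)
    (huv : T.Adj u v) (hvw : T.Adj v w) (hwu : T.Adj w u) : False := by
  have h1 := hp _ _ huv
  have h2 := hp _ _ hvw
  have h3 := hp _ _ hwu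
  rcases h with ⟨hu, hv, hw⟩ | ⟨hu, hv, hw⟩
  · obtain ⟨r, hr, hr'⟩ := hp _ _ hu
    obtain ⟨s, hs, hs'⟩ := hp _ _ hv
    obtain ⟨t, ht, ht'⟩ := hp _ _ hw
    have k1 := circle_lt hr hs (by simpa [hr', hs'] using h1)
    have k2 := circle_lt hs ht (by simpa [hs', ht'] using h2)
    have k3 := circle_lt ht hr (by simpa [ht', hr'] using h3)
    linarith
  · obtain ⟨r, hr, hr'⟩ := hp _ _ hu
    obtain ⟨s, hs, hs'⟩ := hp _ _ hv
    obtain ⟨t, ht, ht'⟩ := hp _ _ hw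
    have k1 := circle_lt hs hr (by simpa [hr', hs'] using h1)
    have k2 := circle_lt ht hs (by simpa [hs', ht'] using h2)
    have k3 := circle_lt hr ht (by simpa [ht', hr'] using h3)
    linarith

end Circle

/-! ### Sequences of ternary digits -/

section Digits

/-- The limit of iterated blow-ups of the cyclic triangle: points are sequences of ternary digits,
compared by the first digit in which they differ, digit `i` being beaten by digit `i - 1`. -/
theorem exists_isRegular_digits {V : Type*} [Fintype V] :
    ∃ W : Tournamenton, W.IsRegular ∧ ∀ T : Digraph V, T.IsTournament → homDensity T W ≠ 0 →
      ∃ p : V → ℕ → ZMod 3, ∀ u v, T.Adj u v →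
        ∃ n, (∀ m < n, (p v - p u) m = 0) ∧ (p v - p u) n = 1 := by
  let μ : Measure (ℕ → ZMod 3) := Measure.addHaarMeasure ⊤
  have : IsProbabilityMeasure μ := ⟨Measure.addHaarMeasure_self⟩
  refine exists_isRegular_of_positive μ (P := {g | ∃ n, (∀ m < n, g m = 0) ∧ g n = 1}) ?_ ?_ ?_
  · have : {g : ℕ → ZMod 3 | ∃ n, (∀ m < n, g m = 0) ∧ g n = 1} =
        ⋃ n, (⋂ m, ⋂ (_ : m < n), {g | g m = 0}) ∩ {g | g n = 1} := by
      ext g; simp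
    rw [this]
    exact MeasurableSet.iUnion fun n => (MeasurableSet.iInter fun m => MeasurableSet.iInter
      fun _ => measurable_pi_apply m (measurableSet_singleton 0)).inter
        (measurable_pi_apply n (measurableSet_singleton 1))
  · rintro g ⟨n, hn, hn1⟩ ⟨m, hm, hm1⟩
    simp only [Pi.neg_apply, neg_eq_zero] at hm hm1
    rcases lt_trichotomy m n with h | rfl | h
    · simp [hn m h] at hm1
    · rw [hn1] at hm1
      exact absurd hm1 (show ¬ (-1 : ZMod 3) = 1 by decide)
    · simp [hm n h] at hn1
  · -- an element without a first nonzero digit vanishes, and invariant measure has no atoms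
    have hzero : μ {0} = 0 := by
      by_contra hne
      have hinf : μ (Set.univ : Set (ℕ → ZMod 3)) = ∞ :=
        Set.infinite_univ.meas_eq_top ⟨μ {0}, hne, fun g _ => by
          rw [← measure_preimage_add_right μ (-g) {0}]
          refine measure_mono fun h hh => ?_
          simpa [add_neg_eq_zero] using hh⟩
      simp at hinf
    refine measure_mono_null (fun g hg => ?_) hzero
    by_contra hg0
    obtain ⟨k, hk⟩ := Function.ne_iff.1 hg0
    classical
    have hex : ∃ k, g k ≠ 0 := ⟨k, hk⟩
    have hmin : ∀ m < Nat.find hex, g m = 0 := fun m hm => not_not.1 (Nat.find_min hex hm)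
    have key : ∀ a : ZMod 3, a ≠ 0 → a = 1 ∨ -a = 1 := by decide
    rcases key _ (Nat.find_spec hex) with h | h
    · exact hg.1 ⟨_, hmin, h⟩
    · exact hg.2 ⟨_, fun m hm => by simp [hmin m hm], h⟩

/-- A tournament drawn on sequences of ternary digits is a cyclic sum of at least two nonempty
parts, given by the first digit which is not the same for all vertices. -/
theorem exists_parts_of_digits {V : Type*} {T : Digraph V} (hT : T.IsTournament)
    {p : V → ℕ → ZMod 3}
    (hp : ∀ u v, T.Adj u v → ∃ n, (∀ m < n, (p v - p u) m = 0) ∧ (p v - p u) n = 1) :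
    Subsingleton V ∨ ∃ f : V → Fin 3, (∃ u v, f u ≠ f v) ∧
      ∀ u v, T.Adj u v → f u ≠ f v → f v = f u + 1 := by
  classical
  by_cases hex : ∃ k, ∃ u v, p u k ≠ p v k
  · right
    have hmin : ∀ m < Nat.find hex, ∀ u v, p u m = p v m := fun m hm u v => by
      by_contra h
      exact Nat.find_min hex hm ⟨u, v, h⟩
    -- `ZMod 3` is `Fin 3` by definition
    refine ⟨fun v => p v (Nat.find hex), Nat.find_spec hex, fun u v huv hne => ?_⟩
    obtain ⟨n, hn, hn1⟩ := hp u v huv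
    rcases lt_trichotomy n (Nat.find hex) with h | h | h
    · simp [hmin n h u v] at hn1
    · rw [← h]
      exact (sub_eq_iff_eq_add'.1 hn1)
    · exact absurd (sub_eq_zero.1 (hn _ h)).symm hne
  · left
    push Not at hex
    refine ⟨fun u v => by_contra fun huv => ?_⟩
    rcases (hT.2 u v huv).or with h | h <;>
    · obtain ⟨n, -, hn⟩ := hp _ _ h
      simp [hex n u v] at hn

end Digits

/-! ### Locally transitive cyclic sums -/

section Classification

variable {V : Type*} {T : Digraph V}

/-- If the in- and out-neighborhoods of all vertices are free of 3-cycles, then so is every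
part of a cyclic sum with at least two nonempty parts: some vertex outside the part dominates it or
is dominated by it. -/
theorem no_cycle_in_part (hT : T.IsTournament)
    (hloc : ∀ u v w z, (T.Adj z u ∧ T.Adj z v ∧ T.Adj z w ∨ T.Adj u z ∧ T.Adj v z ∧ T.Adj w z) →
      T.Adj u v → T.Adj v w → T.Adj w u → False)
    {f : V → Fin 3} (hne : ∃ u v, f u ≠ f v)
    (hf : ∀ u v, T.Adj u v → f u ≠ f v → f v = f u + 1) {u v w : V} (huv : f u = f v)
    (hvw : f v = f w) (h1 : T.Adj u v) (h2 : T.Adj v w) (h3 : T.Adj w u) : False := by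
  obtain ⟨z, hz⟩ : ∃ z, f z ≠ f u := by
    obtain ⟨x, y, hxy⟩ := hne
    by_contra! h
    exact hxy ((h x).trans (h y).symm)
  have key : ∀ i j : Fin 3, i ≠ j → (j = i + 1 ∧ i ≠ j + 1) ∨ (i = j + 1 ∧ j ≠ i + 1) := by decide
  have hadj : ∀ x, f x = f u → T.Adj x z ∨ T.Adj z x := fun x hx =>
    (hT.2 x z fun h => hz (h ▸ hx)).or
  refine hloc u v w z ?_ h1 h2 h3
  rcases key _ _ hz with ⟨-, hno⟩ | ⟨-, hno⟩
  · have : ∀ x, f x = f u → T.Adj z x := fun x hx => (hadj x hx).resolve_left fun h =>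
      hno (hx ▸ hf x z h (hx ▸ hz.symm))
    exact Or.inl ⟨this u rfl, this v huv.symm, this w (hvw.symm.trans huv.symm)⟩
  · have : ∀ x, f x = f u → T.Adj x z := fun x hx => (hadj x hx).resolve_right fun h =>
      hno (hx ▸ hf z x h (hx ▸ hz))
    exact Or.inr ⟨this u rfl, this v huv.symm, this w (hvw.symm.trans huv.symm)⟩

/-- A cyclic sum of three nonempty acyclic parts is of the form `T[a,b,c]`. -/
theorem isIsomorphic_of_surjective [Fintype V] (hT : T.IsTournament) {f : V → Fin 3}
    (hsurj : Function.Surjective f)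
    (hpart : ∀ u v w, f u = f v → f v = f w → T.Adj u v → T.Adj v w → T.Adj w u → False)
    (hf : ∀ u v, T.Adj u v → f u ≠ f v → f v = f u + 1) :
    ∃ a b c : ℕ, 1 ≤ a ∧ 1 ≤ b ∧ 1 ≤ c ∧ T.IsIsomorphic (cyclicBlowupTournament a b c) := by
  classical
  let n : Fin 3 → ℕ := fun i => Fintype.card {v // f v = i}
  have hn : ∀ i, 1 ≤ n i := fun i => by
    obtain ⟨v, hv⟩ := hsurj i
    exact Fintype.card_pos_iff.2 ⟨⟨v, hv⟩⟩
  have hcard : ∀ i, Fintype.card {v // f v = i} = ![n 0, n 1, n 2] i := fun i => by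
    fin_cases i <;> rfl
  have hex : ∀ i, ∃ e : {v // f v = i} ≃ Fin (![n 0, n 1, n 2] i),
      ∀ u v, T.Adj u.1 v.1 ↔ e u < e v := fun i =>
    exists_equiv_fin_lt (r := fun u v : {v // f v = i} => T.Adj u.1 v.1) (fun v => hT.1 v)
      (fun u v huv => (hT.2 u v fun h => huv (Subtype.ext h)).or)
      (fun u v w huv hvw => by
        by_contra huw
        rcases eq_or_ne u w with rfl | hne
        · exact hT.not_adj_of_adj huv hvw
        · exact hpart u v w (u.2.trans v.2.symm) (v.2.trans w.2.symm) huv hvw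
            ((hT.2 u w fun h => hne (Subtype.ext h)).or.resolve_left huw))
      (hcard i)
  choose e he using hex
  refine ⟨n 0, n 1, n 2, hn 0, hn 1, hn 2, ⟨?_⟩⟩
  -- first compare the tournament on the disjoint union of the fibers of `f`
  let r : ((i : Fin 3) × {v // f v = i}) → ((i : Fin 3) × {v // f v = i}) → Prop :=
    fun x y => T.Adj x.2.1 y.2.1
  let e₁ : r ≃r T.Adj := ⟨Equiv.sigmaFiberEquiv f, Iff.rfl⟩
  let e₂ : r ≃r (cyclicBlowupTournament (n 0) (n 1) (n 2)).Adj :=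
    ⟨Equiv.sigmaCongrRight e, by
      rintro ⟨i, u, hu⟩ ⟨j, v, hv⟩
      have key : ∀ i : Fin 3, i ≠ i + 1 := by decide
      have key' : ∀ i : Fin 3, i ≠ i + 1 + 1 := by decide
      by_cases hij : i = j
      · subst hij
        have := he i ⟨u, hu⟩ ⟨v, hv⟩
        simp only [Equiv.sigmaCongrRight_apply, cyclicBlowupTournament, cyclicBlowup,
          r, key, false_or, true_and, this, Fin.lt_def]
      · simp only [Equiv.sigmaCongrRight_apply, cyclicBlowupTournament, cyclicBlowup,
          r, hij, false_and, or_false]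
        constructor
        · rintro rfl
          have hne : u ≠ v := by rintro rfl; exact hij (hu.symm.trans hv)
          refine (hT.2 u v hne).or.resolve_right fun h => ?_
          have := hf v u h (by rw [hu, hv]; exact (key i).symm)
          rw [hu, hv] at this
          exact key' i this
        · intro h
          rw [← hu, ← hv]
          exact hf u v h (by rwa [hu, hv])⟩
  exact e₁.symm.trans e₂

/-- A locally transitive tournament which is a cyclic sum of at least two nonempty parts is
transitive or of the form `T[a,b,c]`, depending on whether a part is missing. -/
theorem transitive_or_cyclicBlowup [Fintype V] (hT : T.IsTournament)
    (hloc : ∀ u v w z, (T.Adj z u ∧ T.Adj z v ∧ T.Adj z w ∨ T.Adj u z ∧ T.Adj v z ∧ T.Adj w z) →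
      T.Adj u v → T.Adj v w → T.Adj w u → False)
    {f : V → Fin 3} (hne : ∃ u v, f u ≠ f v)
    (hf : ∀ u v, T.Adj u v → f u ≠ f v → f v = f u + 1) :
    T.IsTransitiveTournament ∨
      ∃ a b c : ℕ, 1 ≤ a ∧ 1 ≤ b ∧ 1 ≤ c ∧ T.IsIsomorphic (cyclicBlowupTournament a b c) := by
  by_cases hsurj : Function.Surjective f
  · exact Or.inr (isIsomorphic_of_surjective hT hsurj
      (fun u v w => no_cycle_in_part hT hloc hne hf) hf)
  · left
    obtain ⟨c, hc⟩ : ∃ c, ∀ v, f v ≠ c := by simpa [Function.Surjective] using hsurj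
    refine hT.isTransitiveTournament fun u v w huv hvw hwu => ?_
    have key : ∀ i j k c : Fin 3, i ≠ c → j ≠ c → k ≠ c → (i ≠ j → j = i + 1) →
        (j ≠ k → k = j + 1) → (k ≠ i → i = k + 1) → i = j ∧ j = k := by decide
    obtain ⟨h1, h2⟩ := key _ _ _ c (hc u) (hc v) (hc w) (hf u v huv) (hf v w hvw) (hf w u hwu)
    exact no_cycle_in_part hT hloc hne hf h1 h2 huv hvw hwu

end Classification

/-! ### The characterization -/

theorem mainTheorem2 {V : Type*} [Fintype V] (T : Digraph V) (hT : T.IsTournament) :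
    homDensity T Tournamenton.half = (2 : ℝ) ^ (-((Fintype.card V).choose 2 : ℤ)) ∧
    ((∀ W : Tournamenton, W.IsRegular →
        homDensity T W ≥ (2 : ℝ) ^ (-((Fintype.card V).choose 2 : ℤ))) ↔
      (T.IsTransitiveTournament ∨
        ∃ a b c : ℕ, 1 ≤ a ∧ 1 ≤ b ∧ 1 ≤ c ∧
          T.IsIsomorphic (cyclicBlowupTournament a b c))) := by
  refine ⟨homDensity_half hT, fun h => ?_, ?_⟩
  · have hpos : ∀ W : Tournamenton, W.IsRegular → homDensity T W ≠ 0 := fun W hW =>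
      (lt_of_lt_of_le (by positivity) (h W hW)).ne'
    obtain ⟨W₁, hW₁, hcirc⟩ := exists_isRegular_circle (V := V)
    obtain ⟨W₂, hW₂, hdig⟩ := exists_isRegular_digits (V := V)
    obtain ⟨p, hp⟩ := hcirc T hT (hpos W₁ hW₁)
    obtain ⟨q, hq⟩ := hdig T hT (hpos W₂ hW₂)
    rcases exists_parts_of_digits hT hq with hsub | ⟨f, hne, hf⟩
    · exact Or.inl ⟨hT, fun u v w huv _ => absurd (Subsingleton.elim u v ▸ huv) (hT.1 _)⟩
    · exact transitive_or_cyclicBlowup hT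
        (fun u v w z h => no_cycle_in_neighborhood_of_circle hp h) hne hf
  · rintro (h | ⟨a, b, c, ha, hb, -, h⟩) W hW
    · exact h.le_homDensity W
    · exact le_homDensity_of_isIsomorphic ha hb h hW
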